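/- \textbf{Setting.} A cpo is a poset with suprema of all increasing ($\omega$-)chains. A CPO-category is a category whose hom-sets are cpo's and whose composition is Scott continuous; a CPO-functor is a functor that is Scott continuous on hom-sets. In a CPO-category, $e:A\to B$ is an \emph{embedding} if there is a (necessarily unique) $e^\bullet:B\to A$ with $e^\bullet\circ e=\mathrm{id}_A$ and $e\circ e^\bullet\le\mathrm{id}_B$. A \emph{CPO-LNL model} consists of: a symmetric monoidal closed CPO-category $(\mathbf L,\otimes,\multimap,I)$, with $\otimes$ and $\multimap$ CPO-functors, with finite CPO-coproducts $(+,0)$; a CPO-category $\mathbf C$ with finite CPO-products $(\times,1)$ and finite CPO-coproducts $(\amalg,\varnothing)$; and a symmetric monoidal CPO-adjunction $F\dashv G$, $F:\mathbf C\to\mathbf L$, $G:\mathbf L\to\mathbf C$; such that every morphism of $\mathbf L$ out of $0$ is an embedding, $\mathbf L$ has colimits of all $\omega$-diagrams of embeddings, $\mathbf C$ has colimits of all $\omega$-diagrams of \emph{pre-embeddings} (morphisms $f$ such that $Ff$ is an embedding), and the functor $\times:\mathbf C\times\mathbf C\to\mathbf C$ preserves them. Fix such a model. Let $\mathbf L_e$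 be the category of objects of $\mathbf L$ and embeddings, and $\mathbf C_{pe}$ the category of objects of $\mathbf C$ and pre-embeddings; both have an initial object and all $\omega$-colimits. Let $F_{pe}:\mathbf C_{pe}\to\mathbf L_e$, $G_{pe}:\mathbf L_e\to\mathbf C_{pe}$, $!_e:\mathbf L_e\to\mathbf L_e$, $\otimes_e,+_e:\mathbf L_e\times\mathbf L_e\to\mathbf L_e$ and $\times_{pe},\amalg_{pe}:\mathbf C_{pe}\times\mathbf C_{pe}\to\mathbf C_{pe}$ be the restrictions of $F$, $G$, $F\circ G$, $\otimes$, $+$, $\times$, $\amalg$, and let $\multimap_e:\mathbf L_e\times\mathbf L_e\to\mathbf L_e$ be given by $(A,B)\mapsto A\multimap B$, $(e_1,e_2)\mapsto e_1^\bullet\multimap e_2$. For $(\odot,\boxdot)=(\otimes,\times)$ or $(+,\amalg)$, let $\beta^{pe}:\odot_e\circ(F_{pe}\times F_{pe})\Rightarrow F_{pe}\circ\boxdot_{pe}$ be the natural isomorphism given by the monoidal structure of $F$, respectively by the canonical comparison morphisms $FX+FY\to F(X\amalg Y)$. \textbf{The operation $(-)^\dagger$.} Let $\mathbf B$ be a category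 with initial object $\varnothing$ and all $\omega$-colimits. For $T:\mathbf B\to\mathbf B$ let $S(T)$ be the diagram $\varnothing\xrightarrow{\iota}T\varnothing\xrightarrow{T\iota}T^2\varnothing\to\cdots$, which is functorial in $T$. For $T:\mathbf A\times\mathbf B\to\mathbf B$ let $T^\dagger:\mathbf A\to\mathbf B$ be the functor $A\mapsto\mathrm{colim}\,S(T(A,-))$. Let $\mathbf D$ be another such category, with initial object $0$, and let $N:\mathbf A\to\mathbf A'$, $M:\mathbf B\to\mathbf D$, $T:\mathbf A'\times\mathbf D\to\mathbf D$, $H:\mathbf A\times\mathbf B\to\mathbf B$ be functors. For a natural isomorphism $\alpha:T\circ(N\times M)\Rightarrow M\circ H$ and an object $A$ of $\mathbf A$, let $\alpha^*_A:S(T(NA,-))\Rightarrow M\circ S(H(A,-))$ be given by the unique morphism $(\alpha^*_A)_0:0\to M\varnothing$ and by $(\alpha^*_A)_{n+1}=\alpha_{A,H(A,-)^n\varnothing}\circ T(NA,(\alpha^*_A)_n)$, and let $$\alpha^\dagger_A:T^\dagger NA=\mathrm{colim}\,S(T(NA,-))\xrightarrow{\mathrm{colim}(\alpha^*_A)}\mathrm{colim}(M\circ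 S(H(A,-)))\to M\,\mathrm{colim}\,S(H(A,-))=MH^\dagger A,$$ where the second morphism is the canonical one. \textbf{Types.} Types are given by $A,B::=X\mid A+B\mid A\otimes B\mid A\multimap B\mid{!A}\mid\mu X.A$ and non-linear types by $P,R::=X\mid P+R\mid P\otimes R\mid{!A}\mid\mu X.P$ (up to renaming of bound variables). A type context $\Theta$ is a finite list of distinct variables, and $\Theta\vdash A$ means that all free variables of $A$ occur in $\Theta$. The standard interpretation of $\Theta\vdash A$ is the functor $[\![\Theta\vdash A]\!]:\mathbf L_e^{|\Theta|}\to\mathbf L_e$ defined by $[\![\Theta\vdash\Theta_i]\!]=\Pi_i$, $[\![\Theta\vdash{!A}]\!]={!_e}\circ[\![\Theta\vdash A]\!]$, $[\![\Theta\vdash A\star B]\!]=\star_e\circ\langle[\![\Theta\vdash A]\!],[\![\Theta\vdash B]\!]\rangle$ for $\star\in\{+,\otimes,\multimap\}$, and $[\![\Theta\vdash\mu X.A]\!]=[\![\Theta,X\vdash A]\!]^\dagger$. The non-linear interpretation of a non-linear type $\Theta\vdash P$ is the functor $(\!|\Theta\vdash P|\!):\mathbf C_{pe}^{|\Theta|}\to\mathbf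 C_{pe}$ defined by $(\!|\Theta\vdash\Theta_i|\!)=\Pi_i$, $(\!|\Theta\vdash{!A}|\!)=G_{pe}\circ[\![\Theta\vdash A]\!]\circ F_{pe}^{\times|\Theta|}$, $(\!|\Theta\vdash P\odot R|\!)=\boxdot_{pe}\circ\langle(\!|\Theta\vdash P|\!),(\!|\Theta\vdash R|\!)\rangle$, and $(\!|\Theta\vdash\mu X.P|\!)=(\!|\Theta,X\vdash P|\!)^\dagger$. \textbf{Theorem.} In every CPO-LNL model there is exactly one family of natural isomorphisms $$\alpha^{\Theta\vdash P}:[\![\Theta\vdash P]\!]\circ F_{pe}^{\times|\Theta|}\Rightarrow F_{pe}\circ(\!|\Theta\vdash P|\!):\mathbf C_{pe}^{|\Theta|}\to\mathbf L_e,$$ indexed by the non-linear types $\Theta\vdash P$, such that (1) $\alpha^{\Theta\vdash\Theta_i}=\mathrm{id}$ and $\alpha^{\Theta\vdash{!A}}=\mathrm{id}$ (source and target are the same functor in these cases); (2) $\alpha^{\Theta\vdash P\odot R}=\beta^{pe}\langle(\!|\Theta\vdash P|\!),(\!|\Theta\vdash R|\!)\rangle\circ\odot_e\langle\alpha^{\Theta\vdash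 P},\alpha^{\Theta\vdash R}\rangle$ for $\odot\in\{\otimes,+\}$; (3) $\alpha^{\Theta\vdash\mu X.P}=(\alpha^{\Theta,X\vdash P})^\dagger$. -/

import Mathlib

open CategoryTheory CategoryTheory.Limits MonoidalCategory OmegaCompletePartialOrder

universe v u v₁ u₁ v₂ u₂

namespace LNLFPC

/-! ### Categories enriched in cpo's, embeddings -/

/-- A `CPO`-category: every hom-set is a cpo (a poset with suprema of increasing chains) and
composition is Scott continuous. -/
class CPOCategory (C : Type u) [Category.{v} C] where
  homCPO (X Y : C) : OmegaCompletePartialOrder (X ⟶ Y)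
  comp_cont (X Y Z : C) : ωScottContinuous (fun p : (X ⟶ Y) × (Y ⟶ Z) => p.1 ≫ p.2)

attribute [reducible, instance] CPOCategory.homCPO

section Embeddings

variable {C : Type u} [Category.{v} C] [CPOCategory C]

theorem comp_le {X Y Z : C} {f f' : X ⟶ Y} {g g' : Y ⟶ Z} (hf : f ≤ f') (hg : g ≤ g') :
    f ≫ g ≤ f' ≫ g' :=
  (CPOCategory.comp_cont X Y Z).monotone (show ((f, g) : (X ⟶ Y) × (Y ⟶ Z)) ≤ (f', g') from ⟨hf, hg⟩)

theorem comp_cont_right {X Y Z : C} (f : X ⟶ Y) :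
    ωScottContinuous (fun g : Y ⟶ Z => f ≫ g) :=
  ωScottContinuous.comp (g := fun p : (X ⟶ Y) × (Y ⟶ Z) => p.1 ≫ p.2) (f := fun g => (f, g))
    (CPOCategory.comp_cont X Y Z)
    (Prod.ωScottContinuous.prodMk ωScottContinuous.const ωScottContinuous.id)

theorem comp_cont_left {X Y Z : C} (g : Y ⟶ Z) :
    ωScottContinuous (fun f : X ⟶ Y => f ≫ g) :=
  ωScottContinuous.comp (g := fun p : (X ⟶ Y) × (Y ⟶ Z) => p.1 ≫ p.2) (f := fun f => (f, g))
    (CPOCategory.comp_cont X Y Z)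
    (Prod.ωScottContinuous.prodMk ωScottContinuous.id ωScottContinuous.const)

/-- `(e, p)` is an embedding-projection pair. -/
def IsEPPair {A B : C} (e : A ⟶ B) (p : B ⟶ A) : Prop :=
  e ≫ p = 𝟙 A ∧ p ≫ e ≤ 𝟙 B

theorem IsEPPair.unique {A B : C} {e : A ⟶ B} {p q : B ⟶ A} (hp : IsEPPair e p)
    (hq : IsEPPair e q) : p = q := by
  have key : ∀ {p q : B ⟶ A}, IsEPPair e p → IsEPPair e q → p ≤ q := by
    intro p q hp hq
    calc p = (p ≫ e) ≫ q := by rw [Category.assoc, hq.1, Category.comp_id]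
      _ ≤ 𝟙 B ≫ q := comp_le hp.2 le_rfl
      _ = q := Category.id_comp q
  exact le_antisymm (key hp hq) (key hq hp)

theorem IsEPPair.refl (A : C) : IsEPPair (𝟙 A) (𝟙 A) :=
  ⟨Category.id_comp _, (Category.id_comp _).le⟩

theorem IsEPPair.comp {A B D : C} {e : A ⟶ B} {p : B ⟶ A} {e' : B ⟶ D} {p' : D ⟶ B}
    (h : IsEPPair e p) (h' : IsEPPair e' p') : IsEPPair (e ≫ e') (p' ≫ p) := by
  refine ⟨?_, ?_⟩
  · rw [Category.assoc, ← Category.assoc e', h'.1, Category.id_comp, h.1]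
  · calc (p' ≫ p) ≫ e ≫ e' = (p' ≫ (p ≫ e)) ≫ e' := by simp only [Category.assoc]
      _ ≤ (p' ≫ 𝟙 B) ≫ e' := comp_le (comp_le le_rfl h.2) le_rfl
      _ = p' ≫ e' := by rw [Category.comp_id]
      _ ≤ 𝟙 D := h'.2

variable (C) in
/-- The embeddings of a `CPO`-category. -/
def embeddings : MorphismProperty C := fun _ _ e => ∃ p, IsEPPair e p

instance : (embeddings C).IsMultiplicative where
  id_mem A := ⟨𝟙 A, IsEPPair.refl A⟩
  comp_mem _ _ := fun ⟨p, hp⟩ ⟨q, hq⟩ => ⟨q ≫ p, hp.comp hq⟩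

theorem embeddings_of_isIso {A B : C} (f : A ⟶ B) [IsIso f] : embeddings C f :=
  ⟨inv f, IsIso.hom_inv_id f, (IsIso.inv_hom_id f).le⟩

variable (C) in
/-- The subcategory `C_e` of embeddings: all objects of `C`, the embeddings as morphisms. -/
abbrev Emb := WideSubcategory (embeddings C)

/-- The projection counterpart `e^•` of an embedding. -/
noncomputable def Emb.proj {A B : Emb C} (e : A ⟶ B) : B.obj ⟶ A.obj := e.property.choose

theorem Emb.proj_spec {A B : Emb C} (e : A ⟶ B) : IsEPPair e.hom (Emb.proj e) :=
  e.property.choose_spec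

theorem Emb.proj_id (A : Emb C) : Emb.proj (𝟙 A) = 𝟙 A.obj :=
  (Emb.proj_spec (𝟙 A)).unique (IsEPPair.refl A.obj)

theorem Emb.proj_comp {A B D : Emb C} (e : A ⟶ B) (e' : B ⟶ D) :
    Emb.proj (e ≫ e') = Emb.proj e' ≫ Emb.proj e :=
  (Emb.proj_spec (e ≫ e')).unique ((Emb.proj_spec e).comp (Emb.proj_spec e'))

variable (C) in
/-- `C` has all `ω`-colimits over embeddings. -/
def HasOmegaColimitsOverEmbeddings : Prop :=
  ∀ D : ℕ ⥤ C, (∀ {i j : ℕ} (f : i ⟶ j), embeddings C (D.map f)) → HasColimit D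

theorem omegaSup_eq_of_eventually {P : Type v} [OmegaCompletePartialOrder P] (c : Chain P) (a : P)
    (N : ℕ) (h : ∀ i, N ≤ i → c i = a) : ωSup c = a := by
  refine le_antisymm (ωSup_le c a fun i => ?_) ?_
  · rw [← h (max i N) (le_max_right _ _)]
    exact c.monotone (le_max_left _ _)
  · rw [← h N le_rfl]
    exact le_ωSup c N

theorem comp_omegaSup {X Y Z : C} (f : X ⟶ Y) (s : Chain (Y ⟶ Z)) (a : X ⟶ Z) (N : ℕ)
    (h : ∀ i, N ≤ i → f ≫ s i = a) : f ≫ ωSup s = a := by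
  rw [(comp_cont_right f).map_ωSup s]
  exact omegaSup_eq_of_eventually _ a N h

variable (C) in
/-- An `ω`-diagram of embedding-projection pairs, unbundled. -/
structure EPChain where
  X : ℕ → C
  d (i j : ℕ) : i ≤ j → (X i ⟶ X j)
  p (i j : ℕ) : i ≤ j → (X j ⟶ X i)
  ep (i j : ℕ) (h : i ≤ j) : IsEPPair (d i j h) (p i j h)
  d_refl (i : ℕ) : d i i le_rfl = 𝟙 (X i)
  d_trans (i j k : ℕ) (hij : i ≤ j) (hjk : j ≤ k) : d i j hij ≫ d j k hjk = d i k (hij.trans hjk)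

namespace EPChain

variable (S : EPChain C)

theorem p_refl (i : ℕ) : S.p i i le_rfl = 𝟙 (S.X i) :=
  (S.ep i i le_rfl).unique (by rw [S.d_refl]; exact IsEPPair.refl _)

theorem p_trans (i j k : ℕ) (hij : i ≤ j) (hjk : j ≤ k) :
    S.p j k hjk ≫ S.p i j hij = S.p i k (hij.trans hjk) :=
  ((S.ep i j hij).comp (S.ep j k hjk)).unique (by rw [S.d_trans]; exact S.ep _ _ _)

/-- The morphism `X i → X k → X j` given by an embedding and a projection. -/
def leg (i j k : ℕ) (hi : i ≤ k) (hj : j ≤ k) : S.X i ⟶ S.X j := S.d i k hi ≫ S.p j k hj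

theorem leg_succ (i j k k' : ℕ) (hi : i ≤ k) (hj : j ≤ k) (hk : k ≤ k') :
    S.leg i j k' (hi.trans hk) (hj.trans hk) = S.leg i j k hi hj := by
  unfold leg
  rw [← S.d_trans i k k' hi hk, ← S.p_trans j k k' hj hk, Category.assoc,
    ← Category.assoc (S.d k k' hk), (S.ep k k' hk).1, Category.id_comp]

theorem leg_indep (i j k k' : ℕ) (hi : i ≤ k) (hj : j ≤ k) (hi' : i ≤ k') (hj' : j ≤ k') :
    S.leg i j k hi hj = S.leg i j k' hi' hj' := by
  rw [← S.leg_succ i j k (max k k') hi hj (le_max_left _ _),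
    ← S.leg_succ i j k' (max k k') hi' hj' (le_max_right _ _)]

/-- `μ` is a colimiting cocone of the underlying `ω`-diagram. -/
structure IsColim {A : C} (μ : ∀ i, S.X i ⟶ A) : Prop where
  w (i j : ℕ) (h : i ≤ j) : S.d i j h ≫ μ j = μ i
  ext {Z : C} (f g : A ⟶ Z) (h : ∀ i, μ i ≫ f = μ i ≫ g) : f = g
  fac {Z : C} (ν : ∀ i, S.X i ⟶ Z) : (∀ i j h, S.d i j h ≫ ν j = ν i) →
    ∃ f : A ⟶ Z, ∀ i, μ i ≫ f = ν i

variable {S} {A : C} {μ : ∀ i, S.X i ⟶ A}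

/-- For compatible morphisms `q i` into the diagram, the increasing chain `q i ≫ μ i`. -/
def chain {Y : C} (hμ : S.IsColim μ) (q : ∀ i, Y ⟶ S.X i)
    (hq : ∀ i j h, q j ≫ S.p i j h = q i) : Chain (Y ⟶ A) where
  toFun i := q i ≫ μ i
  monotone' i j h := by
    change q i ≫ μ i ≤ q j ≫ μ j
    calc q i ≫ μ i = q j ≫ (S.p i j h ≫ S.d i j h) ≫ μ j := by
          rw [← hq i j h, ← hμ.w i j h]; simp only [Category.assoc]
      _ ≤ q j ≫ 𝟙 _ ≫ μ j := comp_le le_rfl (comp_le (S.ep i j h).2 le_rfl)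
      _ = q j ≫ μ j := by rw [Category.id_comp]

/-- The legs of a colimiting cocone over embeddings are embeddings. -/
theorem IsColim.leg_mem (hμ : S.IsColim μ) (i : ℕ) : embeddings C (μ i) := by
  have hex : ∀ j, ∃ f : A ⟶ S.X j, ∀ i, μ i ≫ f =
      S.leg i j (max i j) (le_max_left _ _) (le_max_right _ _) := by
    intro j
    refine hμ.fac _ fun i i' h => ?_
    rw [S.leg_indep i j (max i j) (max i' j) _ _ (h.trans (le_max_left _ _)) (le_max_right _ _)]
    unfold leg
    rw [← Category.assoc, S.d_trans]
  choose q hq using hex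
  have hleg : ∀ i j k (hi : i ≤ k) (hj : j ≤ k), μ i ≫ q j = S.leg i j k hi hj := by
    intro i j k hi hj
    rw [hq]
    exact S.leg_indep i j _ _ _ _ _ _
  have hle : ∀ i j (h : i ≤ j), μ i ≫ q j = S.d i j h := by
    intro i j h
    rw [hleg i j j h le_rfl]
    unfold leg
    rw [S.p_refl, Category.comp_id]
  have hqp : ∀ i j h, q j ≫ S.p i j h = q i := by
    intro i j h
    refine hμ.ext _ _ fun k => ?_
    rw [← Category.assoc, hleg k j (max k j) (le_max_left _ _) (le_max_right _ _),
      hleg k i (max k j) (le_max_left _ _) (h.trans (le_max_right _ _))]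
    unfold leg
    rw [Category.assoc, S.p_trans]
  have hsup : ωSup (chain hμ q hqp) = 𝟙 A := by
    refine hμ.ext _ _ fun j => ?_
    rw [Category.comp_id]
    refine comp_omegaSup _ _ _ j fun k hk => ?_
    change μ j ≫ q k ≫ μ k = μ j
    rw [← Category.assoc, hle j k hk, hμ.w]
  refine ⟨q i, ?_, ?_⟩
  · rw [hle i i le_rfl, S.d_refl]
  · rw [← hsup]
    exact le_ωSup (chain hμ q hqp) i

/-- The morphism out of the colimit that is induced by a cocone of embeddings is an embedding. -/
theorem IsColim.desc_mem (hμ : S.IsColim μ) {Z : C} (ν : ∀ i, S.X i ⟶ Z)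
    (hν : ∀ i j h, S.d i j h ≫ ν j = ν i) (hν' : ∀ i, embeddings C (ν i)) (f : A ⟶ Z)
    (hf : ∀ i, μ i ≫ f = ν i) : embeddings C f := by
  choose q hq using hν'
  have hqp : ∀ i j h, q j ≫ S.p i j h = q i := fun i j h =>
    ((S.ep i j h).comp (hq j)).unique (by rw [hν i j h]; exact hq i)
  refine ⟨ωSup (chain hμ q hqp), ?_, ?_⟩
  · refine hμ.ext _ _ fun j => ?_
    rw [← Category.assoc, hf, Category.comp_id]
    refine comp_omegaSup _ _ _ j fun k hk => ?_
    change ν j ≫ q k ≫ μ k = μ j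
    rw [← hν j k hk, Category.assoc, ← Category.assoc (ν k), (hq k).1, Category.id_comp, hμ.w]
  · rw [(comp_cont_left f).map_ωSup]
    refine ωSup_le _ _ fun i => ?_
    change (q i ≫ μ i) ≫ f ≤ 𝟙 Z
    rw [Category.assoc, hf]
    exact (hq i).2

end EPChain

/-- The chain of embedding-projection pairs given by an `ω`-diagram over embeddings. -/
noncomputable def epChainOf (D : ℕ ⥤ C) (hD : ∀ {i j : ℕ} (f : i ⟶ j), embeddings C (D.map f)) :
    EPChain C where
  X := D.obj
  d _ _ h := D.map (homOfLE h)
  p _ _ h := (hD (homOfLE h)).choose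
  ep _ _ h := (hD (homOfLE h)).choose_spec
  d_refl i := D.map_id i
  d_trans _ _ _ hij hjk := (D.map_comp (homOfLE hij) (homOfLE hjk)).symm

theorem epChainOf_isColim (D : ℕ ⥤ C) (hD : ∀ {i j : ℕ} (f : i ⟶ j), embeddings C (D.map f))
    {c : Cocone D} (hc : IsColimit c) : (epChainOf D hD).IsColim c.ι.app where
  w _ _ h := c.w (homOfLE h)
  ext _ _ h := hc.hom_ext h
  fac ν hν := ⟨hc.desc ⟨_, { app := ν, naturality := fun i j f =>
    (hν i j (leOfHom f)).trans (Category.comp_id _).symm }⟩, fun i => hc.fac _ i⟩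

/-- A colimiting cocone in `C` of an `ω`-diagram over embeddings consists of embeddings. -/
theorem embeddings_ι {D : ℕ ⥤ C} (hD : ∀ {i j : ℕ} (f : i ⟶ j), embeddings C (D.map f))
    {c : Cocone D} (hc : IsColimit c) (i : ℕ) : embeddings C (c.ι.app i) :=
  (epChainOf_isColim D hD hc).leg_mem i

/-- If `c` is a colimiting cocone in `C` of an `ω`-diagram over embeddings, then every cocone of
embeddings factors through `c` by an embedding. -/
theorem embeddings_desc {D : ℕ ⥤ C} (hD : ∀ {i j : ℕ} (f : i ⟶ j), embeddings C (D.map f))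
    {c : Cocone D} (hc : IsColimit c) (s : Cocone D) (hs : ∀ i, embeddings C (s.ι.app i)) :
    embeddings C (hc.desc s) :=
  (epChainOf_isColim D hD hc).desc_mem s.ι.app (fun _ _ h => s.w (homOfLE h)) hs _ (hc.fac s)

theorem Emb.hasColimitsOfShape_nat (h : HasOmegaColimitsOverEmbeddings C) :
    HasColimitsOfShape ℕ (Emb C) where
  has_colimit D := by
    have hD : ∀ {i j : ℕ} (f : i ⟶ j),
        embeddings C ((D ⋙ wideSubcategoryInclusion (embeddings C)).map f) :=
      fun f => (D.map f).property
    have := h _ hD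
    let hc := colimit.isColimit (D ⋙ wideSubcategoryInclusion (embeddings C))
    refine ⟨⟨⟨⟨⟨colimit (D ⋙ wideSubcategoryInclusion (embeddings C))⟩,
      { app := fun i => ⟨_, embeddings_ι hD hc i⟩
        naturality := fun i j f => ?_ }⟩,
      { desc := fun s => ⟨_, embeddings_desc hD hc ((wideSubcategoryInclusion _).mapCocone s)
          fun i => (s.ι.app i).property⟩
        fac := fun s i => ?_
        uniq := fun s m hm => ?_ }⟩⟩⟩
    · exact WideSubcategory.hom_ext _
        ((colimit.cocone (D ⋙ wideSubcategoryInclusion (embeddings C))).ι.naturality f)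
    · exact WideSubcategory.hom_ext _ (hc.fac _ i)
    · exact WideSubcategory.hom_ext _ (hc.uniq ((wideSubcategoryInclusion _).mapCocone s) m.hom
        fun i => congrArg InducedWideCategory.Hom.hom (hm i))

theorem Emb.hasInitial [HasInitial C] (h : ∀ (X : C) (f : ⊥_ C ⟶ X), embeddings C f) :
    HasInitial (Emb C) :=
  IsInitial.hasInitial (X := (⟨⊥_ C⟩ : Emb C))
    (IsInitial.ofUniqueHom (fun X => ⟨initial.to X.obj, h _ _⟩)
      fun _ _ => WideSubcategory.hom_ext _ (Subsingleton.elim _ _))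

end Embeddings

/-! ### `CPO`-functors, finite `CPO`-products and `CPO`-coproducts -/

section CPOFunctors

variable {A : Type u₁} [Category.{v₁} A] [CPOCategory A]
  {B : Type u₂} [Category.{v₂} B] [CPOCategory B]

/-- A functor between `CPO`-categories is a `CPO`-functor if it is Scott continuous on homs. -/
def IsCPOFunctor (T : A ⥤ B) : Prop :=
  ∀ X Y : A, ωScottContinuous (fun f : X ⟶ Y => T.map f)

theorem IsEPPair.map {T : A ⥤ B} (hT : IsCPOFunctor T) {X Y : A} {e : X ⟶ Y} {p : Y ⟶ X}
    (h : IsEPPair e p) : IsEPPair (T.map e) (T.map p) := by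
  refine ⟨?_, ?_⟩
  · rw [← T.map_comp, h.1, T.map_id]
  · rw [← T.map_comp, ← T.map_id]
    exact (hT Y Y).monotone h.2

/-- The restriction `T_e : A_e ⥤ B_e` of a `CPO`-functor to the embeddings. -/
def embFunctor (T : A ⥤ B) (hT : IsCPOFunctor T) : Emb A ⥤ Emb B where
  obj X := ⟨T.obj X.obj⟩
  map e := ⟨T.map e.hom, _, (Emb.proj_spec e).map hT⟩
  map_id X := WideSubcategory.hom_ext _ (T.map_id X.obj)
  map_comp e e' := WideSubcategory.hom_ext _ (T.map_comp e.hom e'.hom)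

variable (A) in
/-- The binary coproducts of `A` are `CPO`-coproducts: copairing
`A(X, Z) × A(Y, Z) → A(X + Y, Z)` is Scott continuous. (Its inverse is so in any case.) -/
def HasCPOCoproducts [HasBinaryCoproducts A] : Prop :=
  ∀ X Y Z : A, ωScottContinuous (fun p : (X ⟶ Z) × (Y ⟶ Z) => coprod.desc p.1 p.2)

variable (A) in
/-- The binary products of the cartesian monoidal category `A` are `CPO`-products: pairing
`A(Z, X) × A(Z, Y) → A(Z, X × Y)` is Scott continuous. (Its inverse is so in any case.) -/
def HasCPOProducts [CartesianMonoidalCategory A] : Prop :=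
  ∀ X Y Z : A, ωScottContinuous
    (fun p : (Z ⟶ X) × (Z ⟶ Y) => CartesianMonoidalCategory.lift p.1 p.2)

variable (A) in
/-- The tensor product of `A` is a `CPO`-functor `A × A ⥤ A`. -/
def IsCPOTensor [MonoidalCategory A] : Prop :=
  ∀ X X' Y Y' : A, ωScottContinuous (fun p : (X ⟶ X') × (Y ⟶ Y') => p.1 ⊗ₘ p.2)

/-- The action `(f ⊸ g) : (X ⊸ Y) ⟶ (X' ⊸ Y')` of the internal hom on morphisms. -/
def ihomMap [MonoidalCategory A] [MonoidalClosed A] {X X' Y Y' : A} (f : X' ⟶ X) (g : Y ⟶ Y') :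
    (ihom X).obj Y ⟶ (ihom X').obj Y' :=
  (MonoidalClosed.pre f).app Y ≫ (ihom X').map g

variable (A) in
/-- The internal hom of `A` is a `CPO`-functor `Aᵒᵖ × A ⥤ A`. -/
def IsCPOInternalHom [MonoidalCategory A] [MonoidalClosed A] : Prop :=
  ∀ X X' Y Y' : A, ωScottContinuous (fun p : (X' ⟶ X) × (Y ⟶ Y') => ihomMap p.1 p.2)

theorem epPair_tensor [MonoidalCategory A] (hA : IsCPOTensor A) {X X' Y Y' : A}
    {e : X ⟶ X'} {p : X' ⟶ X} {e' : Y ⟶ Y'} {p' : Y' ⟶ Y}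
    (h : IsEPPair e p) (h' : IsEPPair e' p') : IsEPPair (e ⊗ₘ e') (p ⊗ₘ p') := by
  refine ⟨?_, ?_⟩
  · rw [tensorHom_comp_tensorHom, h.1, h'.1, id_tensorHom_id]
  · rw [tensorHom_comp_tensorHom, ← id_tensorHom_id]
    exact (hA _ _ _ _).monotone
      (show ((p ≫ e, p' ≫ e') : (X' ⟶ X') × (Y' ⟶ Y')) ≤ (𝟙 X', 𝟙 Y') from ⟨h.2, h'.2⟩)

theorem epPair_coprod [HasBinaryCoproducts A] (hA : HasCPOCoproducts A) {X X' Y Y' : A}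
    {e : X ⟶ X'} {p : X' ⟶ X} {e' : Y ⟶ Y'} {p' : Y' ⟶ Y}
    (h : IsEPPair e p) (h' : IsEPPair e' p') :
    IsEPPair (coprod.map e e') (coprod.map p p') := by
  refine ⟨?_, ?_⟩
  · rw [coprod.map_map, h.1, h'.1, coprod.map_id_id]
  · rw [coprod.map_map, ← coprod.desc_inl_inr]
    have h1 : coprod.map (p ≫ e) (p' ≫ e') =
        coprod.desc ((p ≫ e) ≫ coprod.inl) ((p' ≫ e') ≫ coprod.inr) := by
      refine coprod.hom_ext ?_ ?_
      · rw [coprod.inl_map, coprod.inl_desc]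
      · rw [coprod.inr_map, coprod.inr_desc]
    rw [h1]
    refine (hA _ _ _).monotone (show (((p ≫ e) ≫ coprod.inl, (p' ≫ e') ≫ coprod.inr) :
      (X' ⟶ X' ⨿ Y') × (Y' ⟶ X' ⨿ Y')) ≤ (coprod.inl, coprod.inr) from ⟨?_, ?_⟩)
    · exact (comp_le h.2 le_rfl).trans (Category.id_comp _).le
    · exact (comp_le h'.2 le_rfl).trans (Category.id_comp _).le

theorem ihomMap_id {A : Type u₁} [Category.{v₁} A] [MonoidalCategory A] [MonoidalClosed A] (X Y : A) :
    ihomMap (𝟙 X) (𝟙 Y) = 𝟙 ((ihom X).obj Y) := by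
  simp [ihomMap]

theorem ihomMap_comp {A : Type u₁} [Category.{v₁} A] [MonoidalCategory A] [MonoidalClosed A] {X X' X'' Y Y' Y'' : A}
    (f : X' ⟶ X) (f' : X'' ⟶ X') (g : Y ⟶ Y') (g' : Y' ⟶ Y'') :
    ihomMap (f' ≫ f) (g ≫ g') = ihomMap f g ≫ ihomMap f' g' := by
  simp [ihomMap, MonoidalClosed.pre_map]

theorem epPair_ihom [MonoidalCategory A] [MonoidalClosed A] (hA : IsCPOInternalHom A)
    {X X' Y Y' : A} {e : X ⟶ X'} {p : X' ⟶ X} {e' : Y ⟶ Y'} {p' : Y' ⟶ Y}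
    (h : IsEPPair e p) (h' : IsEPPair e' p') : IsEPPair (ihomMap p e') (ihomMap e p') := by
  refine ⟨?_, ?_⟩
  · rw [← ihomMap_comp, h.1, h'.1, ihomMap_id]
  · rw [← ihomMap_comp, ← ihomMap_id]
    have hm := (hA X' X' Y' Y').monotone
      (show ((p ≫ e, p' ≫ e') : (X' ⟶ X') × (Y' ⟶ Y')) ≤ (𝟙 X', 𝟙 Y') from ⟨h.2, h'.2⟩)
    exact hm

variable (A) in
/-- `⊗_e : A_e × A_e ⥤ A_e`. -/
def tensorEmb [MonoidalCategory A] (hA : IsCPOTensor A) : Emb A × Emb A ⥤ Emb A where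
  obj X := ⟨X.1.obj ⊗ X.2.obj⟩
  map f := ⟨f.1.hom ⊗ₘ f.2.hom, _, epPair_tensor hA (Emb.proj_spec f.1) (Emb.proj_spec f.2)⟩
  map_id _ := WideSubcategory.hom_ext _ (id_tensorHom_id _ _)
  map_comp f g := WideSubcategory.hom_ext _
    (tensorHom_comp_tensorHom f.1.hom f.2.hom g.1.hom g.2.hom).symm

variable (A) in
/-- `+_e : A_e × A_e ⥤ A_e`. -/
noncomputable def coprodEmb [HasBinaryCoproducts A] (hA : HasCPOCoproducts A) :
    Emb A × Emb A ⥤ Emb A where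
  obj X := ⟨X.1.obj ⨿ X.2.obj⟩
  map f := ⟨coprod.map f.1.hom f.2.hom, _, epPair_coprod hA (Emb.proj_spec f.1) (Emb.proj_spec f.2)⟩
  map_id _ := WideSubcategory.hom_ext _ coprod.map_id_id
  map_comp f g := WideSubcategory.hom_ext _
    (coprod.map_map f.1.hom f.2.hom g.1.hom g.2.hom).symm

variable (A) in
/-- The covariant functor `⊸_e : A_e × A_e ⥤ A_e`, which sends a pair of embeddings `(e₁, e₂)` to
`e₁^• ⊸ e₂`. -/
noncomputable def ihomEmb [MonoidalCategory A] [MonoidalClosed A] (hA : IsCPOInternalHom A) :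
    Emb A × Emb A ⥤ Emb A where
  obj X := ⟨(ihom X.1.obj).obj X.2.obj⟩
  map f := ⟨ihomMap (Emb.proj f.1) f.2.hom, _, epPair_ihom hA (Emb.proj_spec f.1) (Emb.proj_spec f.2)⟩
  map_id X := WideSubcategory.hom_ext _
    ((congrArg (ihomMap · (𝟙 X.2.obj)) (Emb.proj_id X.1)).trans (ihomMap_id _ _))
  map_comp f g := WideSubcategory.hom_ext _
    ((congrArg (ihomMap · (f.2.hom ≫ g.2.hom)) (Emb.proj_comp f.1 g.1)).trans
      (ihomMap_comp _ _ _ _))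

end CPOFunctors

/-! ### Initial sequences and parameterised initial algebras -/

section Dagger

variable {B : Type u} [Category.{v} B] [HasInitial B]

/-- `T^n ∅`, where `∅` is the initial object. -/
noncomputable def iterObj (T : B ⥤ B) : ℕ → B
  | 0 => ⊥_ B
  | n + 1 => T.obj (iterObj T n)

/-- `T^n ι : T^n ∅ ⟶ T^(n+1) ∅`, where `ι : ∅ ⟶ T ∅` is the initial morphism. -/
noncomputable def iterMap (T : B ⥤ B) : ∀ n, iterObj T n ⟶ iterObj T (n + 1)
  | 0 => initial.to (T.obj (⊥_ B))
  | n + 1 => T.map (iterMap T n)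

/-- `(τ^{*n})_∅ : T^n ∅ ⟶ H^n ∅`, where `τ^{*n}` is the `n`-fold horizontal composition. -/
noncomputable def iterTrans {T H : B ⥤ B} (τ : T ⟶ H) : ∀ n, iterObj T n ⟶ iterObj H n
  | 0 => 𝟙 (⊥_ B)
  | n + 1 => T.map (iterTrans τ n) ≫ τ.app (iterObj H n)

theorem iterTrans_naturality {T H : B ⥤ B} (τ : T ⟶ H) (n : ℕ) :
    iterMap T n ≫ iterTrans τ (n + 1) = iterTrans τ n ≫ iterMap H n := by
  induction n with
  | zero => exact initialIsInitial.hom_ext _ _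
  | succ n ih =>
    change T.map (iterMap T n) ≫ T.map (iterTrans τ (n + 1)) ≫ τ.app _ =
      (T.map (iterTrans τ n) ≫ τ.app _) ≫ H.map (iterMap H n)
    rw [Category.assoc, ← τ.naturality, ← Category.assoc, ← Category.assoc, ← T.map_comp,
      ← T.map_comp, ih]

variable (B) in
/-- The functor `S`, which sends `T : B ⥤ B` to its initial sequence `∅ ⟶ T ∅ ⟶ T² ∅ ⟶ ⋯`. -/
noncomputable def initialSequence : (B ⥤ B) ⥤ (ℕ ⥤ B) where
  obj T := Functor.ofSequence (X := iterObj T) (iterMap T)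
  map {T H} τ := NatTrans.ofSequence (iterTrans τ) (fun n => by
    rw [Functor.ofSequence_map_homOfLE_succ, Functor.ofSequence_map_homOfLE_succ]
    exact iterTrans_naturality τ n)
  map_id T := by
    ext n
    induction n with
    | zero => rfl
    | succ n ih =>
      change iterTrans (𝟙 T) n = 𝟙 (iterObj T n) at ih
      change T.map (iterTrans (𝟙 T) n) ≫ 𝟙 _ = 𝟙 (T.obj (iterObj T n))
      rw [ih, T.map_id, Category.comp_id]
  map_comp {T H K} τ σ := by
    ext n
    induction n with
    | zero => exact (Category.comp_id _).symm
    | succ n ih =>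
      change iterTrans (τ ≫ σ) n = iterTrans τ n ≫ iterTrans σ n at ih
      change T.map (iterTrans (τ ≫ σ) n) ≫ τ.app _ ≫ σ.app _ =
        (T.map (iterTrans τ n) ≫ τ.app _) ≫ H.map (iterTrans σ n) ≫ σ.app _
      rw [ih, T.map_comp, Category.assoc, Category.assoc, τ.naturality_assoc]

/-- `T^† : A ⥤ B` for `T : A × B ⥤ B`: the functor `a ↦ colim (S (T (a, -)))`. -/
noncomputable def dagger [HasColimitsOfShape ℕ B] {A : Type u₁} [Category.{v₁} A]
    (T : A × B ⥤ B) : A ⥤ B :=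
  Functor.curry.obj T ⋙ initialSequence B ⋙ colim

variable {D : Type u₂} [Category.{v₂} D] [HasInitial D]
  {A : Type u₁} [Category.{v₁} A] {A' : Type*} [Category* A']
  {N : A ⥤ A'} {M : B ⥤ D} {T : A' × D ⥤ D} {H : A × B ⥤ B}

/-- `(α^*_a)_n : T (N a, -)^n 0 ⟶ M (H (a, -)^n ∅)` for `α : T ∘ (N × M) ⟶ M ∘ H`. -/
noncomputable def starApp (α : N.prod M ⋙ T ⟶ H ⋙ M) (a : A) : ∀ n,
    iterObj ((Functor.curry.obj T).obj (N.obj a)) n ⟶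
      M.obj (iterObj ((Functor.curry.obj H).obj a) n)
  | 0 => initial.to (M.obj (⊥_ B))
  | n + 1 => ((Functor.curry.obj T).obj (N.obj a)).map (starApp α a n) ≫
      α.app (a, iterObj ((Functor.curry.obj H).obj a) n)

theorem starApp_naturality (α : N.prod M ⋙ T ⟶ H ⋙ M) (a : A) (n : ℕ) :
    iterMap ((Functor.curry.obj T).obj (N.obj a)) n ≫ starApp α a (n + 1) =
      starApp α a n ≫ M.map (iterMap ((Functor.curry.obj H).obj a) n) := by
  induction n with
  | zero => exact initialIsInitial.hom_ext _ _
  | succ n ih =>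
    let T' := (Functor.curry.obj T).obj (N.obj a)
    have h := α.naturality (X := (a, iterObj ((Functor.curry.obj H).obj a) n))
      (Y := (a, iterObj ((Functor.curry.obj H).obj a) (n + 1)))
      (𝟙 a, iterMap ((Functor.curry.obj H).obj a) n)
    have h' : T'.map (M.map (iterMap ((Functor.curry.obj H).obj a) n)) ≫
        α.app (a, iterObj ((Functor.curry.obj H).obj a) (n + 1)) =
        α.app (a, iterObj ((Functor.curry.obj H).obj a) n) ≫
          M.map (((Functor.curry.obj H).obj a).map (iterMap ((Functor.curry.obj H).obj a) n)) := by
      refine Eq.trans ?_ h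
      refine congrArg (· ≫ _) ?_
      change T.map _ = T.map _
      refine congrArg T.map (Prod.ext ?_ rfl)
      exact (N.map_id a).symm
    change T'.map (iterMap T' n) ≫ T'.map (starApp α a (n + 1)) ≫
        α.app (a, iterObj ((Functor.curry.obj H).obj a) (n + 1)) =
      (T'.map (starApp α a n) ≫ α.app (a, iterObj ((Functor.curry.obj H).obj a) n)) ≫
        M.map (((Functor.curry.obj H).obj a).map _)
    rw [Category.assoc]
    refine Eq.trans ?_ (congrArg (T'.map (starApp α a n) ≫ ·) h')
    refine (Category.assoc _ _ _).symm.trans (Eq.trans ?_ (Category.assoc _ _ _))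
    refine congrArg (· ≫ _) ?_
    exact (T'.map_comp _ _).symm.trans ((congrArg T'.map ih).trans (T'.map_comp _ _))

/-- `α^*_a : S (T (N a, -)) ⟶ M ∘ S (H (a, -))`. -/
noncomputable def star (α : N.prod M ⋙ T ⟶ H ⋙ M) (a : A) :
    (initialSequence D).obj ((Functor.curry.obj T).obj (N.obj a)) ⟶
      (initialSequence B).obj ((Functor.curry.obj H).obj a) ⋙ M :=
  NatTrans.ofSequence (starApp α a) (fun n =>
    (congrArg (· ≫ _) (Functor.ofSequence_map_homOfLE_succ _ n)).trans
      ((starApp_naturality α a n).trans (congrArg (fun f => _ ≫ M.map f)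
        (Functor.ofSequence_map_homOfLE_succ _ n).symm)))

/-- The component at `a` of `α^† : T^† ∘ N ⟶ M ∘ H^†`: the colimit of `α^*_a`, followed by the
canonical morphism `colim (M ∘ S (H (a, -))) ⟶ M (colim (S (H (a, -))))`, which is an isomorphism
if `M` preserves `ω`-colimits. -/
noncomputable def daggerApp [HasColimitsOfShape ℕ B] [HasColimitsOfShape ℕ D]
    (α : N.prod M ⋙ T ⟶ H ⋙ M) (a : A) :
    (dagger T).obj (N.obj a) ⟶ M.obj ((dagger H).obj a) :=
  colim.map (star α a) ≫
    colimit.post ((initialSequence B).obj ((Functor.curry.obj H).obj a)) M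

end Dagger

/-! ### Finite powers of categories -/

/-- The `n`-th power of the objects of a category. -/
def Pow (B : Type u) : ℕ → Type u
  | 0 => PUnit
  | n + 1 => Pow B n × B

/-- The power category `B^n`, with `B^0` terminal and `B^(n+1) = B^n × B`. -/
instance powCategory (B : Type u) [Category.{v} B] : ∀ n, Category.{v} (Pow B n)
  | 0 =>
    { Hom := fun _ _ => PUnit
      id := fun _ => PUnit.unit
      comp := fun _ _ => PUnit.unit }
  | n + 1 => letI := powCategory B n; inferInstanceAs (Category.{v} (Pow B n × B))

/-- The projections `B^n ⥤ B`. As variables are counted from the right, `0` is the last one. -/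
def powProj (B : Type u) [Category.{v} B] : ∀ {n : ℕ}, Fin n → (Pow B n ⥤ B)
  | 0, i => i.elim0
  | n + 1, i => Fin.cases (motive := fun _ => Pow B (n + 1) ⥤ B)
      (CategoryTheory.Prod.snd (Pow B n) B)
      (fun j => CategoryTheory.Prod.fst (Pow B n) B ⋙ powProj B j) i

/-- `M^{×n} : B^n ⥤ D^n`. -/
def powMap {B : Type u₁} [Category.{v₁} B] {D : Type u₂} [Category.{v₂} D] (M : B ⥤ D) :
    ∀ n, Pow B n ⥤ Pow D n
  | 0 => { obj := fun _ => PUnit.unit, map := fun _ => PUnit.unit }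
  | n + 1 => (powMap M n).prod M

theorem powMap_comp_powProj {B : Type u₁} [Category.{v₁} B] {D : Type u₂} [Category.{v₂} D]
    (M : B ⥤ D) {n : ℕ} (i : Fin n) : powMap M n ⋙ powProj D i = powProj B i ⋙ M := by
  induction n with
  | zero => exact i.elim0
  | succ n ih =>
    refine Fin.cases rfl (fun j => ?_) i
    exact congrArg (CategoryTheory.Prod.fst (Pow B n) B ⋙ ·) (ih j)

/-! ### Types -/

/-- The well-formed types in a type context with `n` variables, up to renaming of bound variables:
`var i` is the `i`-th variable of the context, counted from the right and starting from `0`, and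
`mu` binds the last variable of the extended context. -/
inductive Ty : ℕ → Type
  | var {n : ℕ} (i : Fin n) : Ty n
  | sum {n : ℕ} (A B : Ty n) : Ty n
  | tensor {n : ℕ} (A B : Ty n) : Ty n
  | lolli {n : ℕ} (A B : Ty n) : Ty n
  | bang {n : ℕ} (A : Ty n) : Ty n
  | mu {n : ℕ} (A : Ty (n + 1)) : Ty n

/-- The well-formed non-linear types `P, R ::= X | P + R | P ⊗ R | !A | μX.P`. -/
inductive NTy : ℕ → Type
  | var {n : ℕ} (i : Fin n) : NTy n
  | sum {n : ℕ} (P R : NTy n) : NTy n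
  | tensor {n : ℕ} (P R : NTy n) : NTy n
  | bang {n : ℕ} (A : Ty n) : NTy n
  | mu {n : ℕ} (P : NTy (n + 1)) : NTy n

/-- A non-linear type is a type. -/
def NTy.toTy : ∀ {n : ℕ}, NTy n → Ty n
  | _, .var i => .var i
  | _, .sum P R => .sum P.toTy R.toTy
  | _, .tensor P R => .tensor P.toTy R.toTy
  | _, .bang A => .bang A
  | _, .mu P => .mu P.toTy

/-! ### Models -/

/-- The morphisms of `C` that `F : C ⥤ L` sends to embeddings: the pre-embeddings. -/
abbrev preEmbeddings {C : Type u₁} [Category.{v₁} C] {L : Type u₂} [Category.{v₂} L]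
    [CPOCategory L] (F : C ⥤ L) : MorphismProperty C :=
  (embeddings L).inverseImage F

/-- A `CPO`-LNL model. (The bijection `L(F X, Y) ≃ C(X, G Y)` is automatically an isomorphism of
cpo's, as it is given by composition and the action of `CPO`-functors.) -/
structure CPOLNLModel where
  /-- the linear category -/
  L : Type u₂
  [catL : Category.{v₂} L]
  [cpoL : CPOCategory L]
  [monL : MonoidalCategory L]
  [symL : SymmetricCategory L]
  [closedL : MonoidalClosed L]
  tensorL : IsCPOTensor L
  ihomL : IsCPOInternalHom L
  [finL : HasFiniteCoproducts L]
  coprodL : HasCPOCoproducts L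
  /-- the cartesian category -/
  C : Type u₁
  [catC : Category.{v₁} C]
  [cpoC : CPOCategory C]
  [monC : CartesianMonoidalCategory C]
  [brC : BraidedCategory C]
  prodC : HasCPOProducts C
  [finC : HasFiniteCoproducts C]
  coprodC : HasCPOCoproducts C
  /-- the left adjoint, a lax symmetric monoidal `CPO`-functor -/
  F : C ⥤ L
  [monF : F.LaxBraided]
  cpoF : IsCPOFunctor F
  /-- the right adjoint, a lax symmetric monoidal `CPO`-functor -/
  G : L ⥤ C
  [monG : G.LaxBraided]
  cpoG : IsCPOFunctor G
  /-- the symmetric monoidal adjunction: its unit and counit are monoidal -/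
  adj : F ⊣ G
  [monUnit : NatTrans.IsMonoidal adj.unit]
  [monCounit : NatTrans.IsMonoidal adj.counit]
  /-- the initial object of `L` is e-initial -/
  eInitial (X : L) (f : ⊥_ L ⟶ X) : embeddings L f
  colimL : HasOmegaColimitsOverEmbeddings L
  /-- `C` has all `ω`-colimits over pre-embeddings -/
  colimC (D : ℕ ⥤ C) (hD : ∀ {i j : ℕ} (f : i ⟶ j), preEmbeddings F (D.map f)) : HasColimit D
  /-- the product functor `C × C ⥤ C` preserves `ω`-colimits over pre-embeddings -/
  prodColimC (D : ℕ ⥤ C × C) (hD : ∀ {i j : ℕ} (f : i ⟶ j),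
    preEmbeddings F (D.map f).1 ∧ preEmbeddings F (D.map f).2) :
    PreservesColimit D (MonoidalCategory.tensor C)

namespace CPOLNLModel

attribute [instance] catL cpoL monL symL closedL finL catC cpoC monC brC finC monF monG monUnit
  monCounit

variable (M : CPOLNLModel.{v₁, u₁, v₂, u₂})

/-- The category `L_e` of embeddings of `L`. -/
abbrev Le := Emb M.L

/-- The category `C_pe` of pre-embeddings of `C` with respect to `F`. -/
abbrev Cpe := WideSubcategory (preEmbeddings M.F)

instance : HasInitial M.Le := Emb.hasInitial M.eInitial

instance : HasColimitsOfShape ℕ M.Le := Emb.hasColimitsOfShape_nat M.colimL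

instance : HasInitial M.Cpe :=
  IsInitial.hasInitial (X := (⟨⊥_ M.C⟩ : M.Cpe))
    (IsInitial.ofUniqueHom
      (fun X => ⟨initial.to X.obj, by
        have := M.adj.leftAdjoint_preservesColimits
        let i : ⊥_ M.L ≅ M.F.obj (⊥_ M.C) := (PreservesInitial.iso M.F).symm
        have h := (embeddings M.L).comp_mem i.inv (i.hom ≫ M.F.map (initial.to X.obj))
          (embeddings_of_isIso _) (M.eInitial _ _)
        rwa [Iso.inv_hom_id_assoc] at h⟩)
      fun _ _ => WideSubcategory.hom_ext _ (Subsingleton.elim _ _))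

instance : HasColimitsOfShape ℕ M.Cpe where
  has_colimit D := by
    have := M.adj.leftAdjoint_preservesColimits
    let D' : ℕ ⥤ M.C := D ⋙ wideSubcategoryInclusion (preEmbeddings M.F)
    have hD : ∀ {i j : ℕ} (f : i ⟶ j), embeddings M.L ((D' ⋙ M.F).map f) :=
      fun f => (D.map f).property
    have := M.colimC D' hD
    let hc := colimit.isColimit D'
    let hFc := isColimitOfPreserves M.F hc
    refine ⟨⟨⟨⟨⟨colimit D'⟩,
      { app := fun i => ⟨_, embeddings_ι hD hFc i⟩
        naturality := fun i j f => ?_ }⟩,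
      { desc := fun s => ⟨hc.desc ((wideSubcategoryInclusion _).mapCocone s), ?_⟩
        fac := fun s i => ?_
        uniq := fun s m hm => ?_ }⟩⟩⟩
    · exact WideSubcategory.hom_ext _ ((colimit.cocone D').ι.naturality f)
    · have h := embeddings_desc hD hFc
        (M.F.mapCocone ((wideSubcategoryInclusion _).mapCocone s)) fun i => (s.ι.app i).property
      have h' : hFc.desc (M.F.mapCocone ((wideSubcategoryInclusion _).mapCocone s)) =
          M.F.map (hc.desc ((wideSubcategoryInclusion _).mapCocone s)) :=
        hFc.hom_ext fun i => (hFc.fac _ i).trans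
          (((M.F.map_comp _ _).symm.trans (congrArg M.F.map (hc.fac _ i))).symm)
      rw [h'] at h
      exact h
    · exact WideSubcategory.hom_ext _ (hc.fac _ i)
    · exact WideSubcategory.hom_ext _ (hc.uniq ((wideSubcategoryInclusion _).mapCocone s) m.hom
        fun i => congrArg InducedWideCategory.Hom.hom (hm i))

/-- `F_pe : C_pe ⥤ L_e`, the restriction of `F`. -/
def Fpe : M.Cpe ⥤ M.Le where
  obj X := ⟨M.F.obj X.obj⟩
  map f := ⟨M.F.map f.hom, f.property⟩
  map_id X := WideSubcategory.hom_ext _ (M.F.map_id X.obj)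
  map_comp f g := WideSubcategory.hom_ext _ (M.F.map_comp f.hom g.hom)

/-- The inclusion `C_e ⥤ C_pe`. -/
def embInclusion : Emb M.C ⥤ M.Cpe where
  obj X := ⟨X.obj⟩
  map e := ⟨e.hom, _, (Emb.proj_spec e).map M.cpoF⟩

/-- `G_pe : L_e ⥤ C_pe`, the restriction of `G` to embeddings followed by the inclusion. -/
def Gpe : M.Le ⥤ M.Cpe := embFunctor M.G M.cpoG ⋙ M.embInclusion

theorem cpo_bang : IsCPOFunctor (M.G ⋙ M.F) := fun X Y =>
  ωScottContinuous.comp (g := fun f => M.F.map f) (f := fun f : X ⟶ Y => M.G.map f)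
    (M.cpoF _ _) (M.cpoG X Y)

/-- `!_e : L_e ⥤ L_e`, the restriction of `! = F ∘ G`. -/
def bangE : M.Le ⥤ M.Le := embFunctor (M.G ⋙ M.F) M.cpo_bang

/-- `⊗_e : L_e × L_e ⥤ L_e`. -/
def tensorE : M.Le × M.Le ⥤ M.Le := tensorEmb M.L M.tensorL

/-- `+_e : L_e × L_e ⥤ L_e`. -/
noncomputable def sumE : M.Le × M.Le ⥤ M.Le := coprodEmb M.L M.coprodL

/-- `⊸_e : L_e × L_e ⥤ L_e`. -/
noncomputable def lolliE : M.Le × M.Le ⥤ M.Le := ihomEmb M.L M.ihomL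

/-- The monoidal structure morphism `m : F X ⊗ F Y ⟶ F (X × Y)` is an isomorphism. -/
instance isIso_μ (X Y : M.C) : IsIso (Functor.LaxMonoidal.μ M.F X Y) := by
  refine ⟨M.F.map ((M.adj.unit.app X ⊗ₘ M.adj.unit.app Y) ≫
    Functor.LaxMonoidal.μ M.G (M.F.obj X) (M.F.obj Y)) ≫ M.adj.counit.app _, ?_, ?_⟩
  · have h := NatTrans.IsMonoidal.tensor (τ := M.adj.counit) (M.F.obj X) (M.F.obj Y)
    rw [Functor.LaxMonoidal.comp_μ, Functor.LaxMonoidal.id_μ, Category.comp_id] at h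
    rw [M.F.map_comp, Category.assoc, ← Functor.LaxMonoidal.μ_natural_assoc]
    refine (congrArg (_ ≫ ·) ((Category.assoc _ _ _).symm.trans h)).trans ?_
    refine (tensorHom_comp_tensorHom _ _ _ _).trans ?_
    rw [M.adj.left_triangle_components, M.adj.left_triangle_components]
    exact id_tensorHom_id _ _
  · have h := NatTrans.IsMonoidal.tensor (τ := M.adj.unit) X Y
    rw [Functor.LaxMonoidal.comp_μ, Functor.LaxMonoidal.id_μ, Category.id_comp] at h
    refine (M.adj.homEquiv _ _).injective ?_
    rw [M.adj.homEquiv_unit, M.adj.homEquiv_unit, M.G.map_id]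
    refine Eq.trans ?_ (h.symm.trans (Category.comp_id _).symm)
    simp

/-- `F` preserves binary coproducts: `c : F X + F Y ⟶ F (X ⨿ Y)` is an isomorphism. -/
instance isIso_coprodComparison (X Y : M.C) : IsIso (coprodComparison M.F X Y) := by
  have := M.adj.leftAdjoint_preservesColimits
  infer_instance

/-- `×_pe : C_pe × C_pe ⥤ C_pe`, the restriction of the product functor of `C`. -/
def prodPe : M.Cpe × M.Cpe ⥤ M.Cpe where
  obj X := ⟨X.1.obj ⊗ X.2.obj⟩
  map {X Y} f := ⟨f.1.hom ⊗ₘ f.2.hom, by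
    have h : M.F.map (f.1.hom ⊗ₘ f.2.hom) = inv (Functor.LaxMonoidal.μ M.F X.1.obj X.2.obj) ≫
        (M.F.map f.1.hom ⊗ₘ M.F.map f.2.hom) ≫ Functor.LaxMonoidal.μ M.F Y.1.obj Y.2.obj := by
      rw [Functor.LaxMonoidal.μ_natural, IsIso.inv_hom_id_assoc]
    change embeddings M.L (M.F.map (f.1.hom ⊗ₘ f.2.hom))
    rw [h]
    exact (embeddings M.L).comp_mem _ _ (embeddings_of_isIso _) ((embeddings M.L).comp_mem _ _
      (M.tensorE.map ((M.Fpe.map f.1, M.Fpe.map f.2) :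
        (M.Fpe.obj X.1, M.Fpe.obj X.2) ⟶ (M.Fpe.obj Y.1, M.Fpe.obj Y.2))).property
      (embeddings_of_isIso _))⟩
  map_id _ := WideSubcategory.hom_ext _ (id_tensorHom_id _ _)
  map_comp f g := WideSubcategory.hom_ext _
    (tensorHom_comp_tensorHom f.1.hom f.2.hom g.1.hom g.2.hom).symm

/-- `⨿_pe : C_pe × C_pe ⥤ C_pe`, the restriction of the coproduct functor of `C`. -/
noncomputable def coprodPe : M.Cpe × M.Cpe ⥤ M.Cpe where
  obj X := ⟨X.1.obj ⨿ X.2.obj⟩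
  map {X Y} f := ⟨coprod.map f.1.hom f.2.hom, by
    have h : M.F.map (coprod.map f.1.hom f.2.hom) =
        inv (coprodComparison M.F X.1.obj X.2.obj) ≫
          coprod.map (M.F.map f.1.hom) (M.F.map f.2.hom) ≫
            coprodComparison M.F Y.1.obj Y.2.obj := by
      rw [← coprodComparison_natural, IsIso.inv_hom_id_assoc]
    change embeddings M.L (M.F.map (coprod.map f.1.hom f.2.hom))
    rw [h]
    exact (embeddings M.L).comp_mem _ _ (embeddings_of_isIso _) ((embeddings M.L).comp_mem _ _
      (M.sumE.map ((M.Fpe.map f.1, M.Fpe.map f.2) :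
        (M.Fpe.obj X.1, M.Fpe.obj X.2) ⟶ (M.Fpe.obj Y.1, M.Fpe.obj Y.2))).property
      (embeddings_of_isIso _))⟩
  map_id _ := WideSubcategory.hom_ext _ coprod.map_id_id
  map_comp f g := WideSubcategory.hom_ext _
    (coprod.map_map f.1.hom f.2.hom g.1.hom g.2.hom).symm

/-- The component `F X ⊗ F Y ⟶ F (X × Y)` in `L_e` of the natural isomorphism `β^pe` for the
tensor product. -/
def betaTensor (X Y : M.Cpe) :
    M.tensorE.obj (M.Fpe.obj X, M.Fpe.obj Y) ⟶ M.Fpe.obj (M.prodPe.obj (X, Y)) :=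
  ⟨Functor.LaxMonoidal.μ M.F X.obj Y.obj,
    @embeddings_of_isIso _ _ _ _ _ _ (M.isIso_μ X.obj Y.obj)⟩

/-- The component `F X + F Y ⟶ F (X ⨿ Y)` in `L_e` of the natural isomorphism `β^pe` for the
sum. -/
noncomputable def betaSum (X Y : M.Cpe) :
    M.sumE.obj (M.Fpe.obj X, M.Fpe.obj Y) ⟶ M.Fpe.obj (M.coprodPe.obj (X, Y)) :=
  ⟨coprodComparison M.F X.obj Y.obj,
    @embeddings_of_isIso _ _ _ _ _ _ (M.isIso_coprodComparison X.obj Y.obj)⟩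

/-! ### The interpretations of types -/

/-- The standard interpretation `⟦Θ ⊢ A⟧ : L_e^n ⥤ L_e`. -/
noncomputable def interp : ∀ {n : ℕ}, Ty n → (Pow M.Le n ⥤ M.Le)
  | _, .var i => powProj M.Le i
  | _, .sum A B => (interp A).prod' (interp B) ⋙ M.sumE
  | _, .tensor A B => (interp A).prod' (interp B) ⋙ M.tensorE
  | _, .lolli A B => (interp A).prod' (interp B) ⋙ M.lolliE
  | _, .bang A => interp A ⋙ M.bangE
  | n, .mu A => dagger (A := Pow M.Le n) (B := M.Le) (interp A)

/-- The non-linear interpretation `⦇Θ ⊢ P⦈ : C_pe^n ⥤ C_pe`. -/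
noncomputable def nlInterp : ∀ {n : ℕ}, NTy n → (Pow M.Cpe n ⥤ M.Cpe)
  | _, .var i => powProj M.Cpe i
  | _, .sum P R => (nlInterp P).prod' (nlInterp R) ⋙ M.coprodPe
  | _, .tensor P R => (nlInterp P).prod' (nlInterp R) ⋙ M.prodPe
  | n, .bang A => powMap M.Fpe n ⋙ M.interp A ⋙ M.Gpe
  | n, .mu P => dagger (A := Pow M.Cpe n) (B := M.Cpe) (nlInterp P)

/-- The two sides of the comparison are the same functor in the case of a variable. -/
theorem comparison_var {n : ℕ} (i : Fin n) :
    powMap M.Fpe n ⋙ M.interp (NTy.toTy (.var i)) = M.nlInterp (.var i) ⋙ M.Fpe :=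
  powMap_comp_powProj M.Fpe i

/-- The two sides of the comparison are the same functor in the case of a type `!A`. -/
theorem comparison_bang {n : ℕ} (A : Ty n) :
    powMap M.Fpe n ⋙ M.interp (NTy.toTy (.bang A)) = M.nlInterp (.bang A) ⋙ M.Fpe :=
  rfl

end CPOLNLModel

end LNLFPC

/-! The conditions are the clauses of a recursion on `P`, so uniqueness is an induction on types,
and existence amounts to checking that each clause produces a natural isomorphism. The variable and
`!A` clauses are identities. For sums and tensors, `β^pe` is invertible and natural because the
structure morphisms of `F` are.

The content lies in `μX.P`: `α^†` must be a natural isomorphism whenever `α` is. Both properties are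
checked along the initial sequences. The maps `α^*_a` are natural in `a` by induction on the iterate
(`iterTrans_comp_starApp`), and this passes to the colimit (`daggerApp_naturality`). For
invertibility, `α^*_a` is built from the unique map `0 → F_pe ∅` by applying functors and composing
with components of `α`, and is followed by the canonical map `colim (F_pe ∘ S) → F_pe (colim S)`.
Hence `α^†` is invertible as soon as `F_pe` preserves the initial object and `ω`-colimits
(`isIso_daggerApp`).

As a left adjoint, `F` preserves both, but the claim concerns the non-full subcategories `L_e` and
`C_pe`. There the mediating morphisms must be embeddings or pre-embeddings. This follows from
`embeddings_desc`, where a projection is built as a supremum of composites through the stages of the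
diagram (`preservesColimitsOfShape_Fpe`, `isIso_initialTo_Fpe`). -/

namespace LNLFPC

/-! ### Naturality and invertibility of `α^†`. -/

section Dagger

variable {B : Type u} [Category.{v} B] [HasInitial B]
  {D : Type u₂} [Category.{v₂} D] [HasInitial D]
  {A : Type u₁} [Category.{v₁} A] {A' : Type*} [Category* A']
  {N : A ⥤ A'} {M : B ⥤ D} {T : A' × D ⥤ D} {H : A × B ⥤ B}

/-- Naturality of `α^*` in the parameter, stage by stage. At stage `0` both sides start at an
initial object. The successor step pastes three squares: naturality of `T (N f, -)` at the previous
stage of `α^*_b`, the induction hypothesis under `T (N a, -)`, and naturality of `α` at a morphism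
that moves both variables. -/
theorem iterTrans_comp_starApp (α : N.prod M ⋙ T ⟶ H ⋙ M) {a b : A} (f : a ⟶ b) (n : ℕ) :
    iterTrans ((Functor.curry.obj T).map (N.map f)) n ≫ starApp α b n =
      starApp α a n ≫ M.map (iterTrans ((Functor.curry.obj H).map f) n) := by
  induction n with
  | zero => exact initialIsInitial.hom_ext _ _
  | succ n ih =>
    let Ta := (Functor.curry.obj T).obj (N.obj a)
    let τ := (Functor.curry.obj T).map (N.map f)
    let σ := (Functor.curry.obj H).map f
    let Ha := (Functor.curry.obj H).obj a
    let Hb := (Functor.curry.obj H).obj b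
    have hτ := τ.naturality (starApp α b n)
    have h := α.naturality (X := (a, iterObj Ha n)) (Y := (b, iterObj Hb n)) (f, iterTrans σ n)
    -- Currying splits a morphism of the product category into a move in the second variable
    -- followed by one in the first. `hT` and `hH` recombine the two moves, so that naturality of
    -- `α` in both variables at once applies.
    have hT : Ta.map (M.map (iterTrans σ n)) ≫ τ.app (M.obj (iterObj Hb n)) =
        T.map ((N.map f, M.map (iterTrans σ n)) :
          (N.obj a, M.obj (iterObj Ha n)) ⟶ (N.obj b, M.obj (iterObj Hb n))) := by
      change T.map _ ≫ T.map _ = T.map _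
      rw [← T.map_comp]
      exact congrArg T.map (Prod.ext (Category.id_comp _) (Category.comp_id _))
    have hH : Ha.map (iterTrans σ n) ≫ σ.app (iterObj Hb n) =
        H.map ((f, iterTrans σ n) : (a, iterObj Ha n) ⟶ (b, iterObj Hb n)) := by
      change H.map _ ≫ H.map _ = H.map _
      rw [← H.map_comp]
      exact congrArg H.map (Prod.ext (Category.id_comp _) (Category.comp_id _))
    calc (Ta.map (iterTrans τ n) ≫ τ.app _) ≫
          ((Functor.curry.obj T).obj (N.obj b)).map (starApp α b n) ≫ α.app (b, iterObj Hb n)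
        = Ta.map (iterTrans τ n ≫ starApp α b n) ≫ τ.app _ ≫ α.app (b, iterObj Hb n) := by
          rw [Category.assoc, ← Category.assoc (τ.app _), ← hτ, Ta.map_comp]
          simp only [Category.assoc]
          rfl
      _ = Ta.map (starApp α a n) ≫ (Ta.map (M.map (iterTrans σ n)) ≫ τ.app _) ≫
            α.app (b, iterObj Hb n) := by
          rw [ih, Ta.map_comp]
          simp only [Category.assoc]
          rfl
      _ = Ta.map (starApp α a n) ≫ α.app (a, iterObj Ha n) ≫
            M.map (H.map ((f, iterTrans σ n) : (a, iterObj Ha n) ⟶ (b, iterObj Hb n))) := by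
          rw [hT]
          exact congrArg (Ta.map (starApp α a n) ≫ ·) h
      _ = (Ta.map (starApp α a n) ≫ α.app (a, iterObj Ha n)) ≫
            M.map (Ha.map (iterTrans σ n) ≫ σ.app (iterObj Hb n)) := by
          rw [hH, Category.assoc]

/-- Preservation of the initial object enters only at stage `0`. Each later stage is a functor
applied to an isomorphism, followed by a component of `α`. -/
theorem isIso_starApp [IsIso (initial.to (M.obj (⊥_ B)))] (α : N.prod M ⋙ T ≅ H ⋙ M) (a : A)
    (n : ℕ) : IsIso (starApp α.hom a n) := by
  induction n with
  | zero => assumption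
  | succ n ih =>
    exact IsIso.comp_isIso' (f := ((Functor.curry.obj T).obj (N.obj a)).map (starApp α.hom a n))
      inferInstance (inferInstanceAs
        (IsIso (α.hom.app (a, iterObj ((Functor.curry.obj H).obj a) n))))

variable [HasColimitsOfShape ℕ B] [HasColimitsOfShape ℕ D]

/-- The inclusion `H (a, -)^n ∅ ⟶ H^† a`. -/
noncomputable def daggerι (H : A × B ⥤ B) (a : A) (n : ℕ) :
    iterObj ((Functor.curry.obj H).obj a) n ⟶ (dagger H).obj a :=
  colimit.ι ((initialSequence B).obj ((Functor.curry.obj H).obj a)) n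

theorem dagger_hom_ext {a : A} {Z : B} {f g : (dagger H).obj a ⟶ Z}
    (h : ∀ n, daggerι H a n ≫ f = daggerι H a n ≫ g) : f = g :=
  colimit.hom_ext h

theorem daggerι_map (H : A × B ⥤ B) {a b : A} (f : a ⟶ b) (n : ℕ) :
    daggerι H a n ≫ (dagger H).map f =
      iterTrans ((Functor.curry.obj H).map f) n ≫ daggerι H b n :=
  ι_colimMap ((initialSequence B).map ((Functor.curry.obj H).map f)) n

/-- By `dagger_hom_ext` these equations characterise `α^†_a`. They reduce its naturality to
statements about the stages of the initial sequences. -/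
theorem daggerι_daggerApp (α : N.prod M ⋙ T ⟶ H ⋙ M) (a : A) (n : ℕ) :
    daggerι T (N.obj a) n ≫ daggerApp α a = starApp α a n ≫ M.map (daggerι H a n) :=
  (Category.assoc _ _ _).symm.trans <| (congrArg (· ≫ _) (ι_colimMap (star α a) n)).trans <|
    (Category.assoc _ _ _).trans <| congrArg (starApp α a n ≫ ·) (colimit.ι_post _ M n)

theorem daggerApp_naturality (α : N.prod M ⋙ T ⟶ H ⋙ M) {a b : A} (f : a ⟶ b) :
    (dagger T).map (N.map f) ≫ daggerApp α b = daggerApp α a ≫ M.map ((dagger H).map f) := by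
  refine dagger_hom_ext fun n => ?_
  rw [← Category.assoc, ← Category.assoc, daggerι_map, daggerι_daggerApp, Category.assoc,
    daggerι_daggerApp, Category.assoc, ← M.map_comp, daggerι_map, M.map_comp, ← Category.assoc,
    iterTrans_comp_starApp, Category.assoc]

theorem isIso_daggerApp [IsIso (initial.to (M.obj (⊥_ B)))] [PreservesColimitsOfShape ℕ M]
    (α : N.prod M ⋙ T ≅ H ⋙ M) (a : A) : IsIso (daggerApp α.hom a) := by
  have : ∀ n, IsIso ((star α.hom a).app n) := isIso_starApp α a
  have : IsIso (star α.hom a) := NatIso.isIso_of_isIso_app _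
  -- This is where preservation of `ω`-colimits by `M` is used.
  have : IsIso (colimit.post ((initialSequence B).obj ((Functor.curry.obj H).obj a)) M) := by
    infer_instance
  exact IsIso.comp_isIso' (f := colim.map (star α.hom a)) inferInstance this

/-- The natural isomorphism `α^† : T^† ∘ N ≅ M ∘ H^†`, for `M` preserving the initial object and
`ω`-colimits. -/
noncomputable def daggerIso [IsIso (initial.to (M.obj (⊥_ B)))] [PreservesColimitsOfShape ℕ M]
    (α : N.prod M ⋙ T ≅ H ⋙ M) : N ⋙ dagger T ≅ dagger H ⋙ M :=
  NatIso.ofComponents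
    (fun a => @asIso _ _ _ _ (daggerApp α.hom a) (isIso_daggerApp α a))
    (daggerApp_naturality α.hom)

end Dagger

/-! ### Isomorphisms and `ω`-colimits in the category of embeddings. -/

section Embeddings

variable {C : Type u} [Category.{v} C] [CPOCategory C]

/-- The inverse is again an isomorphism, hence an embedding, so it lies in the subcategory. -/
theorem Emb.isIso_of_isIso_hom {A B : Emb C} (f : A ⟶ B) [IsIso f.hom] : IsIso f :=
  ⟨⟨inv f.hom, embeddings_of_isIso _⟩, WideSubcategory.hom_ext _ (IsIso.hom_inv_id f.hom),
    WideSubcategory.hom_ext _ (IsIso.inv_hom_id f.hom)⟩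

/-- A cocone in `C_e` under an `ω`-diagram is colimiting if it is so in `C`. -/
noncomputable def Emb.isColimitOfInclusion {D : ℕ ⥤ Emb C} {c : Cocone D}
    (hc : IsColimit ((wideSubcategoryInclusion (embeddings C)).mapCocone c)) : IsColimit c where
  -- The subcategory is not full, so the mediating morphism of `C` has to be shown to be an
  -- embedding. The order on hom-sets enters here, through `embeddings_desc`.
  desc s := ⟨hc.desc ((wideSubcategoryInclusion _).mapCocone s),
    embeddings_desc (fun f => (D.map f).property) hc
      ((wideSubcategoryInclusion _).mapCocone s) fun i => (s.ι.app i).property⟩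
  fac s i := WideSubcategory.hom_ext _ (hc.fac ((wideSubcategoryInclusion _).mapCocone s) i)
  uniq s m hm := WideSubcategory.hom_ext _
    (hc.uniq ((wideSubcategoryInclusion _).mapCocone s) m.hom
      fun i => congrArg InducedWideCategory.Hom.hom (hm i))

end Embeddings

/-! ### Preservation of the initial object and of `ω`-colimits by `F_pe`, and invertibility of
`β^pe`. -/

namespace CPOLNLModel

variable (M : CPOLNLModel.{v₁, u₁, v₂, u₂})

/-- The colimit taken in `C` carries a cocone `c` in `C_pe` that is colimiting there and has a
colimiting image in `L_e`. Any other colimiting cocone is isomorphic to `c`, so its image is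
colimiting too. -/
instance preservesColimitsOfShape_Fpe : PreservesColimitsOfShape ℕ M.Fpe where
  preservesColimit {D} := by
    have := M.adj.leftAdjoint_preservesColimits
    let J := wideSubcategoryInclusion (preEmbeddings M.F)
    let D' : ℕ ⥤ M.C := D ⋙ J
    have hD : ∀ {i j : ℕ} (f : i ⟶ j), embeddings M.L ((D' ⋙ M.F).map f) :=
      fun f => (D.map f).property
    have := M.colimC D' hD
    let hFc := isColimitOfPreserves M.F (colimit.isColimit D')
    -- The legs are pre-embeddings: `F` sends them to the legs of a colimit in `L` over embeddings,
    -- and those are embeddings by `embeddings_ι`.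
    let c : Cocone D := ⟨⟨colimit D'⟩,
      { app := fun i => ⟨colimit.ι D' i, embeddings_ι hD hFc i⟩
        naturality := fun i j f => WideSubcategory.hom_ext _
          ((colimit.cocone D').ι.naturality f) }⟩
    have hF : IsColimit (M.Fpe.mapCocone c) := Emb.isColimitOfInclusion hFc
    refine ⟨fun {c'} hc' => ⟨hF.ofIsoColimit ((Cocone.functoriality D M.Fpe).mapIso ?_)⟩⟩
    let hc : IsColimit c :=
      -- The mediating morphism of `C` is a pre-embedding because `F` sends it to the mediating
      -- morphism that `hF` provides in `L_e`, which is an embedding.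
      { desc := fun s => ⟨(colimit.isColimit D').desc (J.mapCocone s), by
          have h : (hF.desc (M.Fpe.mapCocone s)).hom =
              M.F.map ((colimit.isColimit D').desc (J.mapCocone s)) :=
            hFc.hom_ext fun i =>
              (congrArg InducedWideCategory.Hom.hom (hF.fac (M.Fpe.mapCocone s) i)).trans
                ((M.F.map_comp _ _).symm.trans
                  (congrArg M.F.map ((colimit.isColimit D').fac (J.mapCocone s) i))).symm
          obtain ⟨p, hp⟩ := (hF.desc (M.Fpe.mapCocone s)).property
          exact ⟨p, (congrArg (IsEPPair · p) h).mp hp⟩⟩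
        fac := fun s i => WideSubcategory.hom_ext _
          ((colimit.isColimit D').fac (J.mapCocone s) i)
        uniq := fun s m hm => WideSubcategory.hom_ext _
          ((colimit.isColimit D').uniq (J.mapCocone s) m.hom
            fun i => congrArg InducedWideCategory.Hom.hom (hm i)) }
    exact hc.uniqueUpToIso hc'

/-- `F ∅` is initial in `L`. -/
noncomputable def isInitialFInitial : IsInitial (M.F.obj (⊥_ M.C)) :=
  have := M.adj.leftAdjoint_preservesColimits
  initialIsInitial.isInitialObj M.F _

theorem embeddings_from_FInitial {X : M.L} (g : M.F.obj (⊥_ M.C) ⟶ X) : embeddings M.L g := by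
  let i := M.isInitialFInitial.uniqueUpToIso initialIsInitial
  have h := (embeddings M.L).comp_mem i.hom (i.inv ≫ g) (embeddings_of_isIso _) (M.eInitial _ _)
  rwa [Iso.hom_inv_id_assoc] at h

/-- The chosen initial object of `C_pe` is known only up to isomorphism, so the argument goes
through the concrete one, `Z`, whose image `F ∅` is initial in `L` and remains so in `L_e` since all
morphisms out of it are embeddings. -/
instance isIso_initialTo_Fpe : IsIso (initial.to (M.Fpe.obj (⊥_ M.Cpe))) := by
  let Z : M.Cpe := ⟨⊥_ M.C⟩
  let hZ : IsInitial Z :=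
    IsInitial.ofUniqueHom (fun X => ⟨initial.to X.obj, M.embeddings_from_FInitial _⟩)
      fun _ _ => WideSubcategory.hom_ext _ (Subsingleton.elim _ _)
  let hFZ : IsInitial (M.Fpe.obj Z) :=
    IsInitial.ofUniqueHom (fun X => ⟨M.isInitialFInitial.to X.obj, M.embeddings_from_FInitial _⟩)
      fun _ _ => WideSubcategory.hom_ext _ (M.isInitialFInitial.hom_ext _ _)
  exact isIso_of_isInitial initialIsInitial
    (hFZ.ofIso (M.Fpe.mapIso (hZ.uniqueUpToIso initialIsInitial))) _

theorem isIso_betaTensor (X Y : M.Cpe) : IsIso (M.betaTensor X Y) :=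
  have : IsIso (M.betaTensor X Y).hom := M.isIso_μ X.obj Y.obj
  Emb.isIso_of_isIso_hom _

theorem isIso_betaSum (X Y : M.Cpe) : IsIso (M.betaSum X Y) :=
  have : IsIso (M.betaSum X Y).hom := M.isIso_coprodComparison X.obj Y.obj
  Emb.isIso_of_isIso_hom _

theorem betaTensor_naturality {X X' Y Y' : M.Cpe} (f : X ⟶ X') (g : Y ⟶ Y') :
    M.tensorE.map (Prod.mkHom (M.Fpe.map f) (M.Fpe.map g)) ≫ M.betaTensor X' Y' =
      M.betaTensor X Y ≫ M.Fpe.map (M.prodPe.map (Prod.mkHom f g)) :=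
  WideSubcategory.hom_ext _ (Functor.LaxMonoidal.μ_natural M.F f.hom g.hom)

theorem betaSum_naturality {X X' Y Y' : M.Cpe} (f : X ⟶ X') (g : Y ⟶ Y') :
    M.sumE.map (Prod.mkHom (M.Fpe.map f) (M.Fpe.map g)) ≫ M.betaSum X' Y' =
      M.betaSum X Y ≫ M.Fpe.map (M.coprodPe.map (Prod.mkHom f g)) :=
  WideSubcategory.hom_ext _ (coprodComparison_natural M.F f.hom g.hom).symm

end CPOLNLModel

/-! ### The clause shared by `⊗` and `+`, for an arbitrary natural isomorphism `β`. -/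

section Pairing

variable {A : Type u} [Category.{v} A] {B : Type u₁} [Category.{v₁} B]
  {D : Type u₂} [Category.{v₂} D] {M : B ⥤ D} {T : D × D ⥤ D} {H : B × B ⥤ B}
  {P R : A ⥤ D} {P' R' : A ⥤ B}

/-- The natural isomorphism `β ⟨P', R'⟩ ∘ T ⟨α, γ⟩` for `β : T ∘ (M × M) ≅ M ∘ H` given by its
components. -/
noncomputable def pairIso (β : ∀ X Y : B, T.obj (M.obj X, M.obj Y) ⟶ M.obj (H.obj (X, Y)))
    (hβ : ∀ X Y, IsIso (β X Y))
    (hn : ∀ {X X' Y Y' : B} (f : X ⟶ X') (g : Y ⟶ Y'),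
      T.map (Prod.mkHom (M.map f) (M.map g)) ≫ β X' Y' =
        β X Y ≫ M.map (H.map (Prod.mkHom f g)))
    (α : P ≅ P' ⋙ M) (γ : R ≅ R' ⋙ M) : P.prod' R ⋙ T ≅ (P'.prod' R' ⋙ H) ⋙ M :=
  NatIso.ofComponents
    (fun Z => T.mapIso (Iso.prod (α.app Z) (γ.app Z)) ≪≫
      @asIso _ _ _ _ _ (hβ (P'.obj Z) (R'.obj Z)))
    (fun {Y Z} f => by
      change T.map (Prod.mkHom (P.map f) (R.map f)) ≫
          T.map (Prod.mkHom (α.hom.app Z) (γ.hom.app Z)) ≫ β _ _ =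
        (T.map (Prod.mkHom (α.hom.app Y) (γ.hom.app Y)) ≫ β _ _) ≫
          M.map (H.map (Prod.mkHom (P'.map f) (R'.map f)))
      -- Naturality of `β` moves `β` to the right end on both sides. What remains under `T` is
      -- naturality of `α` and `γ`, one in each coordinate.
      rw [Category.assoc, ← hn, ← Category.assoc, ← Category.assoc, ← T.map_comp, ← T.map_comp]
      exact congrArg (fun g => T.map g ≫ β _ _)
        (Prod.ext (α.hom.naturality f) (γ.hom.naturality f)))

end Pairing

/-! ### The comparison isomorphisms and their uniqueness. -/

namespace CPOLNLModel

variable (M : CPOLNLModel.{v₁, u₁, v₂, u₂})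

/-- The comparison `⟦Θ ⊢ P⟧ ∘ F_pe^{×|Θ|} ≅ F_pe ∘ ⦇Θ ⊢ P⦈`. -/
noncomputable def comparison : ∀ (n : ℕ) (P : NTy n),
    powMap M.Fpe n ⋙ M.interp P.toTy ≅ M.nlInterp P ⋙ M.Fpe
  | _, .var i => eqToIso (M.comparison_var i)
  | n, .sum P R => pairIso M.betaSum M.isIso_betaSum M.betaSum_naturality
      (comparison n P) (comparison n R)
  | n, .tensor P R => pairIso M.betaTensor M.isIso_betaTensor M.betaTensor_naturality
      (comparison n P) (comparison n R)
  | _, .bang A => eqToIso (M.comparison_bang A)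
  -- Since `Pow B (n + 1)` and `powMap` at `n + 1` unfold to products, the comparison for the
  -- extended context already has the shape `N.prod M ⋙ T ≅ H ⋙ M`.
  | n, .mu P => daggerIso (N := powMap M.Fpe n) (M := M.Fpe) (T := M.interp P.toTy)
      (H := M.nlInterp P) (comparison (n + 1) P)

end CPOLNLModel

end LNLFPC

theorem mainTheorem3 (M : LNLFPC.CPOLNLModel.{v₁, u₁, v₂, u₂}) :
    ∃! α : ∀ (n : ℕ) (P : LNLFPC.NTy n),
        LNLFPC.powMap M.Fpe n ⋙ M.interp P.toTy ≅ M.nlInterp P ⋙ M.Fpe,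
      (∀ (n : ℕ) (i : Fin n), α n (.var i) = eqToIso (M.comparison_var i)) ∧
      (∀ (n : ℕ) (A : LNLFPC.Ty n), α n (.bang A) = eqToIso (M.comparison_bang A)) ∧
      (∀ (n : ℕ) (P R : LNLFPC.NTy n) (Z : LNLFPC.Pow M.Cpe n),
        (α n (.sum P R)).hom.app Z =
          M.sumE.map (Prod.mkHom ((α n P).hom.app Z) ((α n R).hom.app Z)) ≫
            M.betaSum ((M.nlInterp P).obj Z) ((M.nlInterp R).obj Z)) ∧
      (∀ (n : ℕ) (P R : LNLFPC.NTy n) (Z : LNLFPC.Pow M.Cpe n),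
        (α n (.tensor P R)).hom.app Z =
          M.tensorE.map (Prod.mkHom ((α n P).hom.app Z) ((α n R).hom.app Z)) ≫
            M.betaTensor ((M.nlInterp P).obj Z) ((M.nlInterp R).obj Z)) ∧
      (∀ (n : ℕ) (P : LNLFPC.NTy (n + 1)) (Z : LNLFPC.Pow M.Cpe n),
        (α n (.mu P)).hom.app Z =
          LNLFPC.daggerApp (N := LNLFPC.powMap M.Fpe n) (M := M.Fpe)
            (T := M.interp P.toTy) (H := M.nlInterp P) (α (n + 1) P).hom Z) := by
  -- The conditions are the defining clauses of `comparison`, read off at components.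
  refine ⟨M.comparison, ⟨fun _ _ => rfl, fun _ _ => rfl, fun _ _ _ _ => rfl, fun _ _ _ _ => rfl,
    fun _ _ _ => rfl⟩, ?_⟩
  rintro α ⟨hvar, hbang, hsum, htensor, hmu⟩
  funext n P
  -- The context length varies along the induction: for `mu` the hypothesis concerns the body in the
  -- extended context.
  induction P with
  | var i => exact hvar _ i
  | bang A => exact hbang _ A
  | sum P R ihP ihR =>
    ext Z : 3
    rw [hsum, ihP, ihR]
    rfl
  | tensor P R ihP ihR =>
    ext Z : 3
    rw [htensor, ihP, ihR]
    rfl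
  | mu P ih =>
    ext Z : 3
    rw [hmu, ih]
    rfl
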